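/- Let $\mathcal{E}$ be an elementary topos (a category with finite limits, exponentials and a subobject classifier). Call an object $X$ of $\mathcal{E}$ decidable if its diagonal $X\rightarrowtail X\times X$ is a complemented subobject, and let $\mathrm{dec}(\mathcal{E})$ be the full subcategory of decidable objects. Suppose that $\mathcal{E}$ satisfies the Nullstellensatz (NS): every object of $\mathcal{E}$ either is initial or has a global element. If $\mathrm{dec}(\mathcal{E})$ is reflective, i.e. if its inclusion into $\mathcal{E}$ has a left adjoint, then $\mathrm{dec}(\mathcal{E})$ is an exponential ideal of $\mathcal{E}$: for every decidable object $Y$ and every object $A$ of $\mathcal{E}$, the exponential $Y^{A}$ is decidable. -/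

import Mathlib

open CategoryTheory CategoryTheory.Limits MonoidalCategory CartesianMonoidalCategory

universe v u

namespace DecTopos

/-- The subobject of `Y` represented by the monomorphism `m : A ⟶ Y` is complemented:
there is a subobject `c : B ⟶ Y` such that `Y = A + B` via `m` and `c`.  (In a topos this is the
same as `A` having a complement in the lattice of subobjects of `Y`.  Phrasing it through the
universal property of the coproduct avoids postulating finite colimits.) -/
def IsComplementedSub {C : Type u} [Category.{v} C] {A Y : C} (m : A ⟶ Y) : Prop :=
  Mono m ∧ ∃ (B : C) (c : B ⟶ Y), Mono c ∧ Nonempty (IsColimit (BinaryCofan.mk m c))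

/-- The decidable objects: those `X` whose diagonal `X ⟶ X × X` is a complemented subobject. -/
def dec (E : Type u) [Category.{v} E] [CartesianMonoidalCategory E] : ObjectProperty E :=
  fun X => IsComplementedSub (lift (𝟙 X) (𝟙 X))

/-- The Nullstellensatz: every object is either initial or has a global element. -/
def NS (E : Type u) [Category.{v} E] [CartesianMonoidalCategory E] : Prop :=
  ∀ X : E, Nonempty (IsInitial X) ∨ Nonempty (𝟙_ E ⟶ X)

end DecTopos

namespace DecTopos

/-! ### Subobjects compared through their characteristic maps. -/

section Classifier

variable {C : Type u} [Category.{v} C] (K : Subobject.Classifier C)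

/-! Let `η` be the unit of the reflection at P = Y^A. Evaluation at a global point of A is a map
from P to the decidable object Y, so it factors through `η`. Under NS, maps into a decidable object
are determined by their values at global points (`hom_ext_of_points`). Hence two maps into P
identified by `η` have equal transposes, so `η` is mono, and P is decidable as a subobject of a
decidable object (`dec_of_mono`). This last closure property needs coproduct decompositions to
restrict along monos; that is derived from the classifier and exponentials, without assuming that
further coproducts exist. -/

theorem factors_iff_comp_χ {S Y W : C} (s : S ⟶ Y) [Mono s] (w : W ⟶ Y) :
    (∃ x, x ≫ s = w) ↔ w ≫ K.χ s = K.χ₀ W ≫ K.truth := by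
  constructor
  · rintro ⟨x, rfl⟩
    rw [Category.assoc, (K.isPullback s).w, ← Category.assoc]
    congr 1
    exact Subsingleton.elim _ _
  · intro h
    exact ⟨(K.isPullback s).lift w _ h, (K.isPullback s).lift_fst _ _ _⟩

theorem hom_classifier_ext [HasPullbacks C] {X : C} (φ ψ : X ⟶ K.Ω)
    (h : ∀ (W : C) (w : W ⟶ X),
      w ≫ φ = K.χ₀ W ≫ K.truth ↔ w ≫ ψ = K.χ₀ W ≫ K.truth) : φ = ψ := by
  obtain ⟨Z, i, _, rfl⟩ := K.surjective_χ φ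
  have hi : i ≫ ψ = K.χ₀ Z ≫ K.truth := (h Z i).1 (K.isPullback i).w
  symm
  apply K.uniq i (χ₀' := K.χ₀ Z)
  refine ⟨⟨hi⟩, ⟨PullbackCone.IsLimit.mk _ (fun s => (K.isPullback i).lift s.fst s.snd ?_)
    (fun s => (K.isPullback i).lift_fst _ _ _) (fun s => Subsingleton.elim _ _) ?_⟩⟩
  · have := s.condition
    rw [Subsingleton.elim s.snd (K.χ₀ s.pt)] at this ⊢
    exact (h _ s.fst).2 this
  · intro s l hl _
    rw [← cancel_mono i, hl]
    exact ((K.isPullback i).lift_fst _ _ _).symm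

/-- Comparison of subobjects along a pair of maps that is jointly epic with respect to `Ω`. -/
theorem exists_comp_eq_of_cover [HasPullbacks C] {A B Y S T : C} (a : A ⟶ Y) (b : B ⟶ Y)
    (hab : ∀ φ ψ : Y ⟶ K.Ω, a ≫ φ = a ≫ ψ → b ≫ φ = b ≫ ψ → φ = ψ)
    (s : S ⟶ Y) (t : T ⟶ Y) [Mono s] [Mono t]
    (ha : ∀ (W : C) (w : W ⟶ A), (∃ x, x ≫ s = w ≫ a) ↔ ∃ x, x ≫ t = w ≫ a)
    (hb : ∀ (W : C) (w : W ⟶ B), (∃ x, x ≫ s = w ≫ b) ↔ ∃ x, x ≫ t = w ≫ b) :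
    ∃ k, k ≫ t = s := by
  have key : K.χ s = K.χ t := by
    apply hab
    · apply hom_classifier_ext K
      intro W w
      rw [← Category.assoc, ← Category.assoc, ← factors_iff_comp_χ, ← factors_iff_comp_χ, ha]
    · apply hom_classifier_ext K
      intro W w
      rw [← Category.assoc, ← Category.assoc, ← factors_iff_comp_χ, ← factors_iff_comp_χ, hb]
  rw [factors_iff_comp_χ K, ← key, ← factors_iff_comp_χ]
  exact ⟨𝟙 S, Category.id_comp s⟩

end Classifier

/-! ### Coproducts in a cartesian closed category. -/

section Closed

theorem exists_cofan_desc {C : Type u} [Category.{v} C] {A B Y : C} {m : A ⟶ Y} {c : B ⟶ Y}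
    (hc : IsColimit (BinaryCofan.mk m c)) {T : C} (f : A ⟶ T) (g : B ⟶ T) :
    ∃ d : Y ⟶ T, m ≫ d = f ∧ c ≫ d = g :=
  ⟨_, (BinaryCofan.IsColimit.desc' hc f g).2⟩

variable {C : Type u} [Category.{v} C] [CartesianMonoidalCategory C] [MonoidalClosed C]
  {A B Y : C} {m : A ⟶ Y} {c : B ⟶ Y}

/-- Tensoring with `Z` is a left adjoint, so it preserves the coproduct; this is the uniqueness
half. -/
theorem tensor_cofan_hom_ext (hc : IsColimit (BinaryCofan.mk m c)) {Z T : C} {f g : Z ⊗ Y ⟶ T}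
    (h₁ : Z ◁ m ≫ f = Z ◁ m ≫ g) (h₂ : Z ◁ c ≫ f = Z ◁ c ≫ g) : f = g := by
  apply MonoidalClosed.curry_injective
  apply BinaryCofan.IsColimit.hom_ext hc
  · change m ≫ _ = m ≫ _
    rw [← MonoidalClosed.curry_natural_left, ← MonoidalClosed.curry_natural_left, h₁]
  · change c ≫ _ = c ≫ _
    rw [← MonoidalClosed.curry_natural_left, ← MonoidalClosed.curry_natural_left, h₂]

theorem exists_tensor_cofan_desc (hc : IsColimit (BinaryCofan.mk m c)) {Z T : C}
    (f : Z ⊗ A ⟶ T) (g : Z ⊗ B ⟶ T) :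
    ∃ d : Z ⊗ Y ⟶ T, Z ◁ m ≫ d = f ∧ Z ◁ c ≫ d = g := by
  obtain ⟨d, h₁, h₂⟩ : ∃ d : Y ⟶ (Z ⟶[C] T),
      m ≫ d = MonoidalClosed.curry f ∧ c ≫ d = MonoidalClosed.curry g := exists_cofan_desc hc _ _
  refine ⟨MonoidalClosed.uncurry d, ?_, ?_⟩
  · rw [← MonoidalClosed.uncurry_natural_left]
    rw [h₁, MonoidalClosed.uncurry_curry]
  · rw [← MonoidalClosed.uncurry_natural_left]
    rw [h₂, MonoidalClosed.uncurry_curry]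

/-- If the two injections of a coproduct have a common global element, then all parallel
morphisms are equal. -/
theorem hom_eq_of_common_point (hc : IsColimit (BinaryCofan.mk m c)) {x : 𝟙_ C ⟶ A}
    {y : 𝟙_ C ⟶ B} (hxy : x ≫ m = y ≫ c) {W T : C} (f g : W ⟶ T) : f = g := by
  have points : ∀ {Z : C} (s t : 𝟙_ C ⟶ Z), s = t := by
    intro Z s t
    -- Gluing the constant `s` on `A` with the constant `t` on `B` gives a map whose value at the
    -- common point is both `s` and `t`.
    obtain ⟨d, h₁, h₂⟩ := exists_cofan_desc hc (toUnit A ≫ s) (toUnit B ≫ t)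
    have := hxy =≫ d
    rw [Category.assoc, Category.assoc, h₁, h₂, ← Category.assoc, ← Category.assoc,
      toUnit_unique (x ≫ toUnit A) (𝟙 _), toUnit_unique (y ≫ toUnit B) (𝟙 _)] at this
    simpa using this
  -- Arbitrary maps reduce to points by passing to their names in the internal hom.
  have h := points (MonoidalClosed.curry ((ρ_ W).hom ≫ f)) (MonoidalClosed.curry ((ρ_ W).hom ≫ g))
  exact (cancel_epi (ρ_ W).hom).1 (MonoidalClosed.curry_injective h)

end Closed

/-! ### Stability of coproducts, decidable objects and the reflection. -/

section Topos

variable {C : Type u} [Category.{v} C] [CartesianMonoidalCategory C] [HasFiniteLimits C]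
  [MonoidalClosed C] [HasSubobjectClassifier C] {A B Y : C} {m : A ⟶ Y} {c : B ⟶ Y}

/-- The pullbacks of the injections of a binary coproduct along any map are jointly epic. -/
theorem hom_ext_of_cofan (hc : IsColimit (BinaryCofan.mk m c)) {W T : C} (f : W ⟶ Y)
    {p q : W ⟶ T}
    (hm : ∀ (V : C) (w : V ⟶ W) (z : V ⟶ A), w ≫ f = z ≫ m → w ≫ p = w ≫ q)
    (hc' : ∀ (V : C) (w : V ⟶ W) (z : V ⟶ B), w ≫ f = z ≫ c → w ≫ p = w ≫ q) : p = q := by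
  obtain ⟨⟨K⟩⟩ := ‹HasSubobjectClassifier C›
  have hs : Mono (lift (𝟙 W) f) := mono_of_mono_fac (lift_fst (𝟙 W) f)
  have aux : ∀ {D : C} (d : D ⟶ Y)
      (_ : ∀ (V : C) (w : V ⟶ W) (z : V ⟶ D), w ≫ f = z ≫ d → w ≫ p = w ≫ q)
      (V : C) (w : V ⟶ W ⊗ D), (∃ x, x ≫ lift (𝟙 W) f = w ≫ W ◁ d) ↔
        ∃ x, x ≫ equalizer.ι p q ≫ lift (𝟙 W) f = w ≫ W ◁ d := by
    intro D d hd V w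
    constructor
    · rintro ⟨x, hx⟩
      have h₂ := hx =≫ snd W Y
      simp only [Category.assoc, lift_snd, whiskerLeft_snd] at h₂
      refine ⟨equalizer.lift x (hd V x (w ≫ snd W D) (by simpa using h₂)), ?_⟩
      rw [← Category.assoc, equalizer.lift_ι, hx]
    · rintro ⟨x, hx⟩
      exact ⟨x ≫ equalizer.ι p q, by rw [Category.assoc, hx]⟩
  -- The graph of `f` and its restriction to the equalizer of `p` and `q` agree over `W ⊗ A` and `W
  -- ⊗ B`, so they coincide and the equalizer is all of `W`.
  obtain ⟨k, hk⟩ := exists_comp_eq_of_cover K (W ◁ m) (W ◁ c)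
    (fun φ ψ => tensor_cofan_hom_ext hc) (lift (𝟙 W) f) (equalizer.ι p q ≫ lift (𝟙 W) f)
    (aux m hm) (aux c hc')
  have h₁ := hk =≫ fst W Y
  simp only [Category.assoc, lift_fst, Category.comp_id] at h₁
  rw [← Category.id_comp p, ← Category.id_comp q, ← h₁, Category.assoc, Category.assoc,
    equalizer.condition]

/-- The map is built from its graph: the characteristic maps of the graphs of `g` and `h` glue over
`T ⊗ Y`, and the resulting relation is single-valued and defined on all of `X`. -/
theorem exists_desc_of_isPullback_cofan [Mono m] [Mono c]
    (hc : IsColimit (BinaryCofan.mk m c)) {X A' B' T : C} {f : X ⟶ Y} [Mono f]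
    {m' : A' ⟶ X} {a : A' ⟶ A} {c' : B' ⟶ X} {b : B' ⟶ B}
    (hm : IsPullback m' a f m) (hc' : IsPullback c' b f c) (g : A' ⟶ T) (h : B' ⟶ T) :
    ∃ d : X ⟶ T, m' ≫ d = g ∧ c' ≫ d = h := by
  obtain ⟨⟨K⟩⟩ := ‹HasSubobjectClassifier C›
  have ma : Mono a := hm.mono_snd_of_mono
  have mb : Mono b := hc'.mono_snd_of_mono
  have mga : Mono (lift g a) := mono_of_mono_fac (lift_snd g a)
  have mgb : Mono (lift h b) := mono_of_mono_fac (lift_snd h b)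
  obtain ⟨φ, hφm, hφc⟩ := exists_tensor_cofan_desc hc (K.χ (lift g a)) (K.χ (lift h b))
  obtain ⟨G, i, mi, rfl⟩ := K.surjective_χ φ
  -- `G` is the union of the graphs of `g` and `h`, as a subobject of `T ⊗ Y`.
  have graph : ∀ {D D' : C} (n : D ⟶ Y) (d : D' ⟶ D) (l : D' ⟶ T) [Mono (lift l d)],
      T ◁ n ≫ K.χ i = K.χ (lift l d) → ∀ {W : C} (t : W ⟶ T) (z : W ⟶ D),
      (∃ y, y ≫ i = lift t (z ≫ n)) ↔ ∃ x, x ≫ l = t ∧ x ≫ d = z := by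
    intro D D' n d l _ hn W t z
    have e : lift t (z ≫ n) = lift t z ≫ T ◁ n := by ext <;> simp
    rw [factors_iff_comp_χ K, e, Category.assoc, hn, ← factors_iff_comp_χ]
    constructor
    · rintro ⟨x, hx⟩
      exact ⟨x, by simpa using hx =≫ fst _ _, by simpa using hx =≫ snd _ _⟩
    · rintro ⟨x, rfl, rfl⟩
      exact ⟨x, by ext <;> simp⟩
  have unique : ∀ {D D' : C} (n : D ⟶ Y) (d : D' ⟶ D) (l : D' ⟶ T) [Mono d] [Mono n]
      [Mono (lift l d)], T ◁ n ≫ K.χ i = K.χ (lift l d) →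
      ∀ {W : C} (p q : W ⟶ G), p ≫ i ≫ snd T Y = q ≫ i ≫ snd T Y →
      ∀ (V : C) (w : V ⟶ W) (z : V ⟶ D), w ≫ p ≫ i ≫ snd T Y = z ≫ n → w ≫ p = w ≫ q := by
    intro D D' n d l _ _ _ hn W p q hpq V w z hz
    obtain ⟨x, hx₁, hx₂⟩ := (graph n d l hn (w ≫ p ≫ i ≫ fst T Y) z).1
      ⟨w ≫ p, by ext <;> simp [hz]⟩
    obtain ⟨x', hx₁', hx₂'⟩ := (graph n d l hn (w ≫ q ≫ i ≫ fst T Y) z).1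
      ⟨w ≫ q, by ext <;> simp [← hz, hpq]⟩
    obtain rfl : x = x' := by rw [← cancel_mono d, hx₂, hx₂']
    rw [← cancel_mono i]
    ext
    · simpa using hx₁.symm.trans hx₁'
    · simp [hpq]
  -- Single-valuedness: a point of `G` is determined by its `Y`-component, which can be checked over
  -- `A` and over `B`.
  have mr : Mono (i ≫ snd T Y) := ⟨fun p q hpq =>
    hom_ext_of_cofan hc (p ≫ i ≫ snd T Y)
      (fun V w z hz => unique m a g hφm p q hpq V w z hz)
      (fun V w z hz => unique c b h hφc p q hpq V w z hz)⟩
  have domain : ∀ {D D' : C} (n : D ⟶ Y) (d : D' ⟶ D) (n' : D' ⟶ X) (l : D' ⟶ T)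
      [Mono (lift l d)], T ◁ n ≫ K.χ i = K.χ (lift l d) → IsPullback n' d f n →
      ∀ (W : C) (w : W ⟶ D), (∃ x, x ≫ f = w ≫ n) ↔ ∃ x, x ≫ i ≫ snd T Y = w ≫ n := by
    intro D D' n d n' l _ hn hp W w
    constructor
    · rintro ⟨x, hx⟩
      obtain ⟨y, hy⟩ := (graph n d l hn (hp.lift x w hx ≫ l) w).2 ⟨hp.lift x w hx, rfl, by simp⟩
      exact ⟨y, by rw [← Category.assoc, hy, lift_snd]⟩
    · rintro ⟨y, hy⟩
      obtain ⟨x, -, hx⟩ := (graph n d l hn (y ≫ i ≫ fst T Y) w).1 ⟨y, by ext <;> simp [hy]⟩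
      exact ⟨x ≫ n', by rw [Category.assoc, hp.w, ← Category.assoc, hx]⟩
  -- Totality: `k` lifts `X` into the graph.
  obtain ⟨k, hk⟩ := exists_comp_eq_of_cover K m c
    (fun φ ψ h₁ h₂ => BinaryCofan.IsColimit.hom_ext hc h₁ h₂) f (i ≫ snd T Y)
    (domain m a m' g hφm hm) (domain c b c' h hφc hc')
  have value : ∀ {D D' : C} (n : D ⟶ Y) (d : D' ⟶ D) (n' : D' ⟶ X) (l : D' ⟶ T)
      [Mono (lift l d)], T ◁ n ≫ K.χ i = K.χ (lift l d) → IsPullback n' d f n →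
      n' ≫ k ≫ i ≫ fst T Y = l := by
    intro D D' n d n' l _ hn hp
    obtain ⟨y, hy⟩ := (graph n d l hn l d).2 ⟨𝟙 _, by simp, by simp⟩
    have e : n' ≫ k = y := by
      rw [← cancel_mono (i ≫ snd T Y), Category.assoc, hk, hp.w, ← Category.assoc, hy, lift_snd]
    rw [← Category.assoc, e, ← Category.assoc, hy, lift_fst]
  exact ⟨k ≫ i ≫ fst T Y, value m a m' g hφm hm, value c b c' h hφc hc'⟩

/-- Complemented subobjects are stable under pullback along monomorphisms. -/
theorem IsComplementedSub.of_isPullback (hm : IsComplementedSub m) {X A' : C} {f : X ⟶ Y}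
    [Mono f] {m' : A' ⟶ X} {a : A' ⟶ A} (hp : IsPullback m' a f m) : IsComplementedSub m' := by
  obtain ⟨_, B, c, _, ⟨hc⟩⟩ := hm
  have hq := IsPullback.of_hasPullback f c
  refine ⟨hp.mono_fst_of_mono, _, pullback.fst f c, inferInstance, ⟨?_⟩⟩
  choose d hd₁ hd₂ using fun {T : C} (g : A' ⟶ T) (h : pullback f c ⟶ T) =>
    exists_desc_of_isPullback_cofan hc hp hq g h
  refine BinaryCofan.isColimitMk (fun s => d s.inl s.inr) (fun s => hd₁ _ _) (fun s => hd₂ _ _) ?_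
  intro s l h₁ h₂
  refine hom_ext_of_cofan hc f (fun V w z hz => ?_) (fun V w z hz => ?_)
  · rw [← hp.lift_fst w z hz, Category.assoc, Category.assoc, h₁]
    exact congrArg (_ ≫ ·) (hd₁ s.inl s.inr).symm
  · rw [← hq.lift_fst w z hz, Category.assoc, Category.assoc, h₂]
    exact congrArg (_ ≫ ·) (hd₂ s.inl s.inr).symm

/-- Since `f` is mono, the diagonal of `X` is the pullback of that of `D` along `f ⊗ₘ f`. -/
theorem dec_of_mono {X D : C} (f : X ⟶ D) [Mono f] (hD : dec C D) : dec C X := by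
  have : Mono (f ⊗ₘ f) := ⟨fun p q h => by
    ext
    · rw [← cancel_mono f]
      simpa using h =≫ fst _ _
    · rw [← cancel_mono f]
      simpa using h =≫ snd _ _⟩
  refine IsComplementedSub.of_isPullback hD (f := f ⊗ₘ f) (a := f) ?_
  refine ⟨⟨by ext <;> simp⟩, ⟨PullbackCone.IsLimit.mk _ (fun s => s.fst ≫ fst X X) ?_ ?_ ?_⟩⟩
  · intro s
    have h₁ := s.condition =≫ fst D D
    have h₂ := s.condition =≫ snd D D
    ext
    · simp
    · rw [← cancel_mono f]
      simp_all
  · intro s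
    simpa using s.condition =≫ fst D D
  · intro s l h _
    simp [← h]

/-- Under the Nullstellensatz, morphisms to a decidable object are equal as soon as they agree on
global elements. -/
theorem hom_ext_of_points (hNS : NS C) {W D : C} (hD : dec C D) {f g : W ⟶ D}
    (h : ∀ w : 𝟙_ C ⟶ W, w ≫ f = w ≫ g) : f = g := by
  obtain ⟨_, B, c, _, ⟨hc⟩⟩ := hD
  have hq := IsPullback.of_hasPullback (lift f g) c
  -- The pullback is the part of `W` where `f` and `g` differ. If it is initial, they agree
  -- everywhere.
  rcases hNS (pullback (lift f g) c) with ⟨⟨hI⟩⟩ | ⟨⟨w⟩⟩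
  · refine hom_ext_of_cofan hc (lift f g) (fun V w z hz => ?_) (fun V w z hz => ?_)
    · have h₁ := hz =≫ fst D D
      have h₂ := hz =≫ snd D D
      simp only [Category.assoc, lift_fst, lift_snd] at h₁ h₂
      rw [h₁, h₂]
    · rw [← hq.lift_fst w z hz, Category.assoc, Category.assoc, hI.hom_ext (_ ≫ f) (_ ≫ g)]
  -- At a point of that part `f` and `g` still agree, so the diagonal and its complement share a
  -- point and the category collapses.
  · refine hom_eq_of_common_point hc (x := (w ≫ pullback.fst _ _) ≫ f)
      (y := w ≫ pullback.snd _ _) ?_ f g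
    rw [Category.assoc w (pullback.snd _ _), ← pullback.condition]
    ext
    · simp
    · simp [h (w ≫ pullback.fst _ _)]

theorem dec_ihom (hNS : NS C) [Reflective (dec C).ι] {D : C} (hD : dec C D) (A : C) :
    dec C (A ⟶[C] D) := by
  let P : C := A ⟶[C] D
  let L := reflector (dec C).ι
  let adj := reflectorAdjunction (dec C).ι
  let η : P ⟶ (L.obj P).obj := adj.unit.app P
  have factor : ∀ f : P ⟶ D, ∃ f' : (L.obj P).obj ⟶ D, f = η ≫ f' := by
    intro f
    refine ⟨((adj.homEquiv P ⟨D, hD⟩).symm f).hom, ?_⟩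
    have := (adj.homEquiv P ⟨D, hD⟩).apply_symm_apply f
    rw [adj.homEquiv_unit] at this
    exact this.symm
  have mη : Mono η := by
    refine ⟨fun {Z} p q hpq => ?_⟩
    apply MonoidalClosed.uncurry_injective
    refine hom_ext_of_points hNS hD fun w => ?_
    -- Evaluation at the `A`-component of `w`, as a map `P ⟶ D`.
    obtain ⟨f', hf'⟩ := factor (lift (toUnit P ≫ w ≫ fst A Z) (𝟙 P) ≫ (ihom.ev A).app D)
    have eval : ∀ r : Z ⟶ P, w ≫ MonoidalClosed.uncurry r = w ≫ snd A Z ≫ r ≫ η ≫ f' := by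
      intro r
      rw [MonoidalClosed.uncurry_eq, ← hf', ← Category.assoc, ← Category.assoc,
        ← Category.assoc, ← Category.assoc]
      congr 1
      ext
      · simp only [Category.assoc, whiskerLeft_fst, comp_lift]
        rw [← Category.assoc r, ← Category.assoc (snd A Z), ← Category.assoc w,
          toUnit_unique (w ≫ snd A Z ≫ r ≫ toUnit P) (𝟙 _), Category.id_comp, lift_fst]
      · simp
    rw [eval, eval, reassoc_of% hpq]
  exact dec_of_mono η (L.obj P).property

end Topos

end DecTopos

/-- `E` is an elementary topos: finite limits (with chosen finite products), exponentials,
and a subobject classifier. -/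
theorem theoremB (E : Type u) [Category.{v} E] [CartesianMonoidalCategory E] [HasFiniteLimits E]
    [MonoidalClosed E] [HasSubobjectClassifier E] (hNS : DecTopos.NS E)
    [Reflective (DecTopos.dec E).ι] :
    ExponentialIdeal (DecTopos.dec E).ι :=
  ExponentialIdeal.mk' _ fun B A =>
    Functor.obj_mem_essImage (DecTopos.dec E).ι ⟨_, DecTopos.dec_ihom hNS B.property A⟩
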